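/- **Theorem 3.1.** Let $(X,\mathcal B,\mu)$ be a probability space and let $d$ be a metric on $X$ whose open sets belong to $\mathcal B$. Let $T:X\to X$ be an ergodic measure-preserving map, and let $\alpha=\{P_1,\dots,P_l\}$ be a finite partition of $X$ into measurable sets whose boundaries with respect to $d$ satisfy $\mu(\partial P_i)=0$ for $i=1,\dots,l$. Let $$h(T,\alpha)=\lim_{n\to\infty}\frac1n\,H\Big(\bigvee_{k=0}^{n-1}T^{-k}\alpha\Big),\qquad H(\beta)=-\sum_{B\in\beta}\mu(B)\log_2\mu(B)$$ (with $0\log_2 0=0$) denote the metric entropy of $T$ with respect to $\alpha$. If $h(T,\alpha)>0$, then $T$ is symmetrically sensitive: there exists $\delta>0$ such that for $\mu\otimes\mu$-almost every $(x,y)\in X^2$ there is an integer $n\ge 0$ with $d(T^nx,T^ny)\ge\delta$. -/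

import Mathlib

open MeasureTheory Set Filter Topology

namespace SymmetricSensitivity

/-- A finite measurable partition of `X`, given by its family of cells: measurable, pairwise
disjoint sets that cover `X` (empty cells are allowed). -/
structure IsMeasurablePartition {X ι : Type*} [MeasurableSpace X] (P : ι → Set X) : Prop where
  measurableSet : ∀ i, MeasurableSet (P i)
  pairwise_disjoint : Pairwise (fun i j => Disjoint (P i) (P j))
  iUnion_eq : ⋃ i, P i = univ

/-- `A` is a `μ`-continuity set: its topological boundary is `μ`-null. -/
def IsContinuitySet {X : Type*} [TopologicalSpace X] [MeasurableSpace X]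
    (μ : Measure X) (A : Set X) : Prop :=
  μ (frontier A) = 0

/-- The cells of the join `α ∨ T⁻¹α ∨ ⋯ ∨ T⁻⁽ⁿ⁻¹⁾α` of a partition `α = (P i)`, indexed by words
of length `n`: the points `x` with `T ^ k x ∈ P (s k)` for all `k < n`. -/
def joinCells {X ι : Type*} (T : X → X) (P : ι → Set X) (n : ℕ) (s : Fin n → ι) : Set X :=
  ⋂ k : Fin n, T^[(k : ℕ)] ⁻¹' P (s k)

/-- Shannon entropy (in bits) of a finite partition: `H(α) = - ∑ μ(P i) log₂ μ(P i)`,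
where `0 log₂ 0 = 0`. -/
noncomputable def shannonEntropy {X ι : Type*} [MeasurableSpace X] [Fintype ι]
    (μ : Measure X) (P : ι → Set X) : ℝ :=
  -∑ i, μ.real (P i) * Real.logb 2 (μ.real (P i))

/-- Metric entropy of `T` with respect to a finite partition `α`:
`h(T, α) = lim (1 / n) H(α ∨ T⁻¹α ∨ ⋯ ∨ T⁻⁽ⁿ⁻¹⁾α)`. The limit exists for every measurable partition
and every measure-preserving map: see `tendsto_metricEntropy`. -/
noncomputable def metricEntropy {X ι : Type*} [MeasurableSpace X] [Fintype ι]
    (T : X → X) (μ : Measure X) (P : ι → Set X) : ℝ :=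
  limUnder atTop (fun n : ℕ => shannonEntropy μ (joinCells T P n) / n)

/-- `T` is symmetrically sensitive: there is a constant `δ > 0` such that for almost every pair
`(x, y)` some iterate separates `x` and `y` by at least `δ`. -/
def SymmetricallySensitive {X : Type*} [MetricSpace X] [MeasurableSpace X]
    (T : X → X) (μ : Measure X) : Prop :=
  ∃ δ : ℝ, 0 < δ ∧ ∀ᵐ p ∂(μ.prod μ), ∃ n : ℕ, δ ≤ dist (T^[n] p.1) (T^[n] p.2)

/-! The limit in the definition of the metric entropy exists. -/

lemma gibbs {x y : ℝ} (hx : 0 ≤ x) (hy : 0 ≤ y) (h : y = 0 → x = 0) :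
    x * Real.log y ≤ x * Real.log x + (y - x) := by
  rcases hx.eq_or_lt with rfl | hx
  · simpa using hy
  have hy : 0 < y := lt_of_le_of_ne hy (fun h0 => hx.ne' (h h0.symm))
  have h1 := Real.log_le_sub_one_of_pos (div_pos hy hx)
  rw [Real.log_div hy.ne' hx.ne'] at h1
  have h2 := mul_le_mul_of_nonneg_left h1 hx.le
  have h3 : x * (y / x - 1) = y - x := by field_simp
  linarith

lemma sum_subadditive {α β : Type*} [Fintype α] [Fintype β] (p : α → β → ℝ) (q : α → ℝ)
    (r : β → ℝ) (hp : ∀ a b, 0 ≤ p a b) (hq : ∀ a, ∑ b, p a b = q a)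
    (hr : ∀ b, ∑ a, p a b = r b) (h1 : ∑ a, q a = 1) :
    ∑ a, q a * Real.log (q a) + ∑ b, r b * Real.log (r b)
      ≤ ∑ a, ∑ b, p a b * Real.log (p a b) := by
  have hpq : ∀ a b, p a b ≤ q a := fun a b => by
    rw [← hq]; exact Finset.single_le_sum (fun i _ => hp a i) (Finset.mem_univ b)
  have hpr : ∀ a b, p a b ≤ r b := fun a b => by
    rw [← hr]; exact Finset.single_le_sum (f := fun i => p i b)
      (fun i _ => hp i b) (Finset.mem_univ a)
  have hr1 : ∑ b, r b = 1 := by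
    rw [← h1]; simp_rw [← hr, ← hq]; exact Finset.sum_comm
  have key : ∀ a b, p a b * Real.log (q a) + p a b * Real.log (r b)
      ≤ p a b * Real.log (p a b) + (q a * r b - p a b) := fun a b => by
    rcases (hp a b).eq_or_lt with h0 | h0
    · rw [← h0]
      have := mul_nonneg ((hp a b).trans (hpq a b)) ((hp a b).trans (hpr a b))
      simpa using this
    · have ha := h0.trans_le (hpq a b)
      have hb := h0.trans_le (hpr a b)
      have := gibbs h0.le (mul_pos ha hb).le (fun h => absurd h (mul_pos ha hb).ne')
      rw [Real.log_mul ha.ne' hb.ne'] at this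
      linarith
  have e1 : ∑ a, q a * Real.log (q a) = ∑ a, ∑ b, p a b * Real.log (q a) := by
    refine Finset.sum_congr rfl fun a _ => ?_
    rw [← Finset.sum_mul, hq]
  have e2 : ∑ b, r b * Real.log (r b) = ∑ a, ∑ b, p a b * Real.log (r b) := by
    rw [Finset.sum_comm]
    refine Finset.sum_congr rfl fun b _ => ?_
    rw [← Finset.sum_mul, hr]
  have e3 : ∑ a, ∑ b, (q a * r b - p a b) = 0 := by
    simp_rw [Finset.sum_sub_distrib, ← Finset.mul_sum, hq, hr1, mul_one]
    simp
  have := Finset.sum_le_sum fun a (_ : a ∈ Finset.univ) =>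
    Finset.sum_le_sum fun b (_ : b ∈ Finset.univ) => key a b
  simp_rw [Finset.sum_add_distrib] at this
  rw [e3] at this
  linarith

lemma IsMeasurablePartition.joinCells {X ι : Type*} [MeasurableSpace X] {T : X → X}
    {P : ι → Set X} (hP : IsMeasurablePartition P) (hT : Measurable T) (n : ℕ) :
    IsMeasurablePartition (joinCells T P n) where
  measurableSet s := MeasurableSet.iInter fun k => hT.iterate _ (hP.measurableSet _)
  pairwise_disjoint s t hst := by
    obtain ⟨k, hk⟩ := Function.ne_iff.1 hst
    rw [Set.disjoint_left]
    intro x hx hy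
    exact Set.disjoint_left.1 (hP.pairwise_disjoint hk) (Set.mem_iInter.1 hx k)
      (Set.mem_iInter.1 hy k)
  iUnion_eq := by
    refine Set.eq_univ_of_forall fun x => ?_
    have : ∀ k : Fin n, ∃ i, T^[(k : ℕ)] x ∈ P i := fun k =>
      Set.mem_iUnion.1 (hP.iUnion_eq ▸ Set.mem_univ _)
    choose s hs using this
    exact Set.mem_iUnion.2 ⟨s, Set.mem_iInter.2 hs⟩

lemma IsMeasurablePartition.sum_inter {X ι : Type*} [MeasurableSpace X] [Fintype ι]
    {P : ι → Set X} (hP : IsMeasurablePartition P) (μ : Measure X) [IsFiniteMeasure μ]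
    (A : Set X) : ∑ i, μ.real (A ∩ P i) = μ.real A := by
  have h := sum_measureReal_preimage_singleton (μ := μ.restrict A) (Finset.univ : Finset ι)
    (f := fun x => (Set.mem_iUnion.1 (hP.iUnion_eq ▸ Set.mem_univ x : x ∈ ⋃ i, P i)).choose)
  have e : ∀ i, (fun x => (Set.mem_iUnion.1
      (hP.iUnion_eq ▸ Set.mem_univ x : x ∈ ⋃ i, P i)).choose) ⁻¹' {i} = P i := by
    intro i
    ext x
    have hx := (Set.mem_iUnion.1 (hP.iUnion_eq ▸ Set.mem_univ x : x ∈ ⋃ i, P i)).choose_spec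
    simp only [Set.mem_preimage, Set.mem_singleton_iff]
    constructor
    · intro h; rwa [h] at hx
    · intro h
      by_contra hne
      exact Set.disjoint_left.1 (hP.pairwise_disjoint hne) hx h
  simp_rw [e] at h
  have h' := h (fun i _ => hP.measurableSet i)
  simp only [Finset.coe_univ, Set.preimage_univ] at h'
  simpa [measureReal_restrict_apply, hP.measurableSet, Set.inter_comm] using h'

lemma shannonEntropy_nonneg {X ι : Type*} [MeasurableSpace X] [Fintype ι] (μ : Measure X)
    [IsProbabilityMeasure μ] (P : ι → Set X) : 0 ≤ shannonEntropy μ P := by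
  rw [shannonEntropy, ← Finset.sum_neg_distrib]
  refine Finset.sum_nonneg fun i _ => ?_
  have := Real.negMulLog_nonneg (x := μ.real (P i)) measureReal_nonneg measureReal_le_one
  have h2 := div_nonneg this (Real.log_pos one_lt_two).le
  rwa [Real.negMulLog, neg_mul, neg_div, mul_div_assoc] at h2

lemma shannonEntropy_joinCells_subadditive {X ι : Type*} [MeasurableSpace X] [Fintype ι]
    {T : X → X} {μ : Measure X} [IsProbabilityMeasure μ] (hT : MeasurePreserving T μ μ)
    {P : ι → Set X} (hP : IsMeasurablePartition P) :
    Subadditive (fun n => shannonEntropy μ (joinCells T P n)) := by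
  intro m n
  have hm := hP.joinCells hT.measurable m
  have hn := hP.joinCells hT.measurable n
  have happ : ∀ (s : Fin m → ι) (t : Fin n → ι), joinCells T P (m + n) (Fin.append s t)
      = joinCells T P m s ∩ T^[m] ⁻¹' joinCells T P n t := by
    intro s t
    ext x
    simp only [joinCells, Set.mem_iInter, Set.mem_preimage, Set.mem_inter_iff, Fin.forall_fin_add,
      Fin.append_left, Fin.append_right, Fin.val_castAdd, Fin.val_natAdd]
    simp only [← Function.iterate_add_apply, add_comm]
  have hpre : ∀ t, μ.real (T^[m] ⁻¹' joinCells T P n t) = μ.real (joinCells T P n t) := fun t =>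
    (hT.iterate m).measureReal_preimage (hn.measurableSet t).nullMeasurableSet
  have key := sum_subadditive
    (fun s t => μ.real (joinCells T P m s ∩ T^[m] ⁻¹' joinCells T P n t))
    (fun s => μ.real (joinCells T P m s)) (fun t => μ.real (joinCells T P n t))
    (fun _ _ => measureReal_nonneg)
    (fun s => by
      have hpn : IsMeasurablePartition (fun t => T^[m] ⁻¹' joinCells T P n t) :=
        ⟨fun t => (hT.measurable.iterate m) (hn.measurableSet t),
          fun i j hij => (hn.pairwise_disjoint hij).preimage _, by
            rw [← Set.preimage_iUnion, hn.iUnion_eq, Set.preimage_univ]⟩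
      exact hpn.sum_inter μ _)
    (fun t => by
      rw [← hpre t, ← hm.sum_inter μ]
      simp_rw [Set.inter_comm])
    (by simpa using hm.sum_inter μ univ)
  have hsum : ∑ w, μ.real (joinCells T P (m + n) w) * Real.log (μ.real (joinCells T P (m + n) w))
      = ∑ s, ∑ t, μ.real (joinCells T P m s ∩ T^[m] ⁻¹' joinCells T P n t)
        * Real.log (μ.real (joinCells T P m s ∩ T^[m] ⁻¹' joinCells T P n t)) := by
    rw [← Fintype.sum_prod_type', ← (Fin.appendEquiv m n).sum_comp]
    refine Finset.sum_congr rfl fun st _ => ?_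
    rw [← happ]; rfl
  have hl := Real.log_pos one_lt_two
  simp only [shannonEntropy, Real.logb, ← mul_div_assoc, ← Finset.sum_div]
  rw [← hsum] at key
  have := div_le_div_of_nonneg_right key hl.le
  rw [add_div] at this
  linarith

lemma tendsto_metricEntropy {X ι : Type*} [MeasurableSpace X] [Fintype ι]
    {T : X → X} {μ : Measure X} [IsProbabilityMeasure μ] (hT : MeasurePreserving T μ μ)
    {P : ι → Set X} (hP : IsMeasurablePartition P) :
    Tendsto (fun n : ℕ => shannonEntropy μ (joinCells T P n) / n) atTop
      (𝓝 (metricEntropy T μ P)) := by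
  refine tendsto_nhds_limUnder ⟨_, (shannonEntropy_joinCells_subadditive hT hP).tendsto_lim ?_⟩
  refine ⟨0, ?_⟩
  rintro _ ⟨n, rfl⟩
  exact div_nonneg (shannonEntropy_nonneg μ _) n.cast_nonneg

end SymmetricSensitivity

/-!
Write `V` for the set of points at distance less than `δ` from the complement of their cell. As the
boundaries of the cells are null, `V` is small for small `δ`. Two points that stay `δ`-close forever
lie in the same cell at every time at which at least one of them is outside `V`; let `R`
(`agreeOff T a V`) be the set of pairs with this property. Unlike the set of pairs that stay
`δ`-close, `R` is measurable for the product σ-algebra even if `X` is not separable.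

The measure of the section `R x` can only grow along orbits, so by ergodicity either almost every
section is null, and then almost every pair is separated by `δ` at some time, or almost every
section has measure at least some `c > 0`. The latter forces small entropy
(`metricEntropy_le_of_agreeOff`). Indeed, by Markov's inequality most points visit `V` rarely up to
time `n`. Among them choose a maximal family with pairwise disjoint sections; it has at most `1 / c`
members, whatever `n` is. The section of any other such point `x` meets the section of a member `y`
in some `z`, and comparing with `z` shows that the `n`-names of `x` and `y` differ only when `x` or
`y` visits `V` (`hammingDist_le_visits`). So, up to a set of small measure, all `n`-names lie in
boundedly many Hamming balls of radius a small multiple of `n`, and such a distribution has entropy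
at most a small multiple of `n`, up to a constant (`entropy_le_of_hammingDist_le`).
-/

namespace SymmetricSensitivity

/-! ### Entropy of distributions concentrated near few words -/

/-- Kraft-type bound: the weights `exp (-b * hammingDist s w)` are products over the letters, and
each letter contributes at most `1 + |ι| exp (-b)`. -/
lemma sum_exp_neg_hammingDist_le {ι : Type*} [Fintype ι] [DecidableEq ι] {n : ℕ} (b : ℝ)
    (w : Fin n → ι) :
    ∑ s : Fin n → ι, Real.exp (-b * hammingDist s w)
      ≤ Real.exp (n * (Fintype.card ι * Real.exp (-b))) := by
  have hprod : ∀ s : Fin n → ι, Real.exp (-b * hammingDist s w)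
      = ∏ k, if s k ≠ w k then Real.exp (-b) else 1 := by
    intro s
    rw [Finset.prod_ite, Finset.prod_const, Finset.prod_const_one, mul_one, ← Real.exp_nat_mul,
      mul_comm]
    rfl
  have hletter : ∀ i : ι, ∑ a : ι, (if a ≠ i then Real.exp (-b) else 1)
      ≤ Real.exp (Fintype.card ι * Real.exp (-b)) := by
    intro i
    calc ∑ a : ι, (if a ≠ i then Real.exp (-b) else 1)
        ≤ ∑ a : ι, (Real.exp (-b) + if a = i then 1 else 0) := by
          refine Finset.sum_le_sum fun a _ => ?_
          have := (Real.exp_pos (-b)).le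
          split_ifs <;> simp_all
      _ = Fintype.card ι * Real.exp (-b) + 1 := by
          simp [Finset.sum_add_distrib]
      _ ≤ _ := Real.add_one_le_exp _
  calc ∑ s : Fin n → ι, Real.exp (-b * hammingDist s w)
      = ∏ k : Fin n, ∑ a : ι, (if a ≠ w k then Real.exp (-b) else 1) := by
        rw [Finset.prod_univ_sum, Fintype.piFinset_univ]
        exact Finset.sum_congr rfl fun s _ => hprod s
    _ ≤ ∏ _k : Fin n, Real.exp (Fintype.card ι * Real.exp (-b)) :=
        Finset.prod_le_prod (fun k _ => Finset.sum_nonneg fun a _ => by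
          have := (Real.exp_pos (-b)).le
          split_ifs <;> simp_all) fun k _ => hletter _
    _ = _ := by simp [← Real.exp_nat_mul]

/-- If all words outside a set of total mass `η` lie within Hamming distance `D` of one of at most
`M` words, the entropy (in nats) of the distribution `p` is small. This is Gibbs' inequality for `p`
against the average of the uniform distribution and a normalised mixture of the weights
`exp (-b * hammingDist · w)`. -/
lemma entropy_le_of_hammingDist_le {ι : Type*} [Fintype ι] [DecidableEq ι] [Nonempty ι] {n : ℕ}
    {p : (Fin n → ι) → ℝ} (hp : ∀ s, 0 ≤ p s) (hp1 : ∑ s, p s = 1)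
    {t A : Finset (Fin n → ι)} {M : ℕ} (hM : 0 < M) (htM : t.card ≤ M) {b D η : ℝ} (hb : 0 ≤ b)
    (hD : 0 ≤ D) (hA : ∀ s ∈ A, ∃ w ∈ t, (hammingDist s w : ℝ) ≤ D)
    (hη : ∑ s ∈ Aᶜ, p s ≤ η) :
    -∑ s, p s * Real.log (p s) ≤ Real.log (2 * M)
      + (n * (Fintype.card ι * Real.exp (-b)) + b * D) + η * (n * Real.log (Fintype.card ι)) := by
  set c : ℝ := n * (Fintype.card ι * Real.exp (-b)) with hc
  have hc0 : 0 ≤ c := by positivity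
  set N : ℝ := (Fintype.card ι : ℝ) ^ n with hN
  have hcard : (0 : ℝ) < Fintype.card ι := by exact_mod_cast Fintype.card_pos
  have hN0 : 0 < N := pow_pos hcard n
  have hMr : (0 : ℝ) < M := by exact_mod_cast hM
  set q : (Fin n → ι) → ℝ := fun s => 1 / (2 * N)
    + ∑ w ∈ t, Real.exp (-b * hammingDist s w) / (2 * M * Real.exp c) with hq
  have hq_unif : ∀ s, 1 / (2 * N) ≤ q s := fun s =>
    le_add_of_nonneg_right (a := 1 / (2 * N)) (Finset.sum_nonneg fun w _ => by positivity)
  have hq0 : ∀ s, 0 < q s := fun s => lt_of_lt_of_le (by positivity) (hq_unif s)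
  have hqA : ∀ s ∈ A, Real.exp (-(b * D)) / (2 * M * Real.exp c) ≤ q s := by
    intro s hs
    obtain ⟨w, hw, hwD⟩ := hA s hs
    have h1 := Finset.single_le_sum
      (f := fun w => Real.exp (-b * hammingDist s w) / (2 * M * Real.exp c))
      (fun w _ => by positivity) hw
    have h2 : Real.exp (-(b * D)) / (2 * M * Real.exp c)
        ≤ Real.exp (-b * hammingDist s w) / (2 * M * Real.exp c) := by
      gcongr
      nlinarith
    have h3 : 0 < 1 / (2 * N) := by positivity
    simp only [hq]
    linarith
  have hq1 : ∑ s, q s ≤ 1 := by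
    have h1 : ∑ _s : Fin n → ι, 1 / (2 * N) = 1 / 2 := by
      rw [Finset.sum_const, Finset.card_univ, Fintype.card_pi, nsmul_eq_mul]
      simp only [Finset.prod_const, Finset.card_univ, Fintype.card_fin, Nat.cast_pow, ← hN]
      field_simp
    have h2 : ∑ s, ∑ w ∈ t, Real.exp (-b * hammingDist s w) / (2 * M * Real.exp c) ≤ 1 / 2 := by
      rw [Finset.sum_comm]
      calc ∑ w ∈ t, ∑ s, Real.exp (-b * hammingDist s w) / (2 * M * Real.exp c)
          ≤ ∑ _w ∈ t, 1 / (2 * (M : ℝ)) := by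
            refine Finset.sum_le_sum fun w _ => ?_
            rw [← Finset.sum_div, div_le_div_iff₀ (by positivity) (by positivity)]
            have := sum_exp_neg_hammingDist_le b w
            nlinarith
        _ = t.card / (2 * M) := by simp [div_eq_mul_inv]
        _ ≤ 1 / 2 := by
            have : (t.card : ℝ) ≤ M := by exact_mod_cast htM
            rw [div_le_div_iff₀ (by positivity) (by positivity)]
            linarith
    simp only [hq, Finset.sum_add_distrib]
    linarith
  have hgibbs : ∑ s, p s * Real.log (q s) ≤ ∑ s, p s * Real.log (p s) := by
    have h := Finset.sum_le_sum fun s (_ : s ∈ Finset.univ) =>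
      gibbs (hp s) (hq0 s).le (fun h => absurd h (hq0 s).ne')
    rw [Finset.sum_add_distrib, Finset.sum_sub_distrib] at h
    linarith
  have hlogN : Real.log N = n * Real.log (Fintype.card ι) := by rw [hN, Real.log_pow]
  have hlogN0 : 0 ≤ Real.log N := by
    rw [hlogN]
    exact mul_nonneg n.cast_nonneg (Real.log_natCast_nonneg _)
  have hlogM : 0 ≤ Real.log M := Real.log_natCast_nonneg _
  have hlog2M : Real.log (2 * M) = Real.log 2 + Real.log M := Real.log_mul two_ne_zero hMr.ne'
  have hpt : ∀ s, -Real.log (q s) ≤ Real.log (2 * M) + (c + b * D)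
      + if s ∈ Aᶜ then Real.log N else 0 := by
    intro s
    have hbD := mul_nonneg hb hD
    by_cases hs : s ∈ A
    · have := Real.log_le_log (by positivity) (hqA s hs)
      rw [Real.log_div (by positivity) (by positivity), Real.log_mul (by positivity)
        (by positivity), Real.log_exp, Real.log_exp] at this
      simp only [Finset.mem_compl, hs, not_true_eq_false, if_false]
      linarith
    · have := Real.log_le_log (by positivity) (hq_unif s)
      rw [one_div, Real.log_inv, Real.log_mul two_ne_zero hN0.ne'] at this
      simp only [Finset.mem_compl, hs, not_false_eq_true, if_true]
      linarith
  calc -∑ s, p s * Real.log (p s) ≤ ∑ s, p s * -Real.log (q s) := by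
        simp only [mul_neg, Finset.sum_neg_distrib]
        linarith
    _ ≤ ∑ s, p s * (Real.log (2 * M) + (c + b * D) + if s ∈ Aᶜ then Real.log N else 0) :=
        Finset.sum_le_sum fun s _ => mul_le_mul_of_nonneg_left (hpt s) (hp s)
    _ = Real.log (2 * M) + (c + b * D) + (∑ s ∈ Aᶜ, p s) * Real.log N := by
        simp only [mul_add, mul_ite, mul_zero, Finset.sum_add_distrib, ← Finset.sum_mul, hp1]
        rw [Finset.sum_ite_mem, Finset.univ_inter, Finset.sum_mul]
        ring
    _ ≤ _ := by
        rw [← hlogN]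
        gcongr

/-! ### The layer of points close to the boundary of a partition -/

/-- The points at distance less than `δ` from the complement of their own cell. -/
def boundaryLayer {X ι : Type*} [PseudoEMetricSpace X] (P : ι → Set X) (δ : ℝ) : Set X :=
  ⋃ i, P i ∩ Metric.thickening δ (P i)ᶜ

lemma measurableSet_boundaryLayer {X ι : Type*} [PseudoEMetricSpace X] [MeasurableSpace X]
    [OpensMeasurableSpace X] [Countable ι] {P : ι → Set X} (hP : ∀ i, MeasurableSet (P i))
    (δ : ℝ) : MeasurableSet (boundaryLayer P δ) :=
  MeasurableSet.iUnion fun i => (hP i).inter Metric.isOpen_thickening.measurableSet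

lemma mem_of_notMem_boundaryLayer {X ι : Type*} [PseudoMetricSpace X] {P : ι → Set X} {δ : ℝ}
    {x y : X} {i : ι} (hx : x ∉ boundaryLayer P δ) (hxy : dist x y < δ) (hi : x ∈ P i) :
    y ∈ P i := by
  by_contra hy
  exact hx (mem_iUnion.2 ⟨i, hi, Metric.mem_thickening_iff.2 ⟨y, hy, hxy⟩⟩)

/-- As `δ → 0` the layers decrease to a subset of the union of the boundaries of the cells. -/
lemma exists_measureReal_boundaryLayer_lt {X ι : Type*} [PseudoEMetricSpace X] [MeasurableSpace X]
    [OpensMeasurableSpace X] [Fintype ι] {μ : Measure X} [IsFiniteMeasure μ] {P : ι → Set X}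
    (hP : ∀ i, MeasurableSet (P i)) (hcont : ∀ i, IsContinuitySet μ (P i)) {ε : ℝ} (hε : 0 < ε) :
    ∃ δ > 0, μ.real (boundaryLayer P δ) < ε := by
  have hcell : ∀ i, Tendsto (fun δ => μ (P i ∩ Metric.thickening δ (P i)ᶜ)) (𝓝[>] 0) (𝓝 0) := by
    intro i
    have h := tendsto_measure_thickening (μ := μ.restrict (P i)) (s := (P i)ᶜ)
      ⟨1, one_pos, measure_ne_top _ _⟩
    have h0 : μ.restrict (P i) (closure (P i)ᶜ) = 0 := by
      rw [Measure.restrict_apply' (hP i)]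
      refine measure_mono_null ?_ (hcont i)
      rw [frontier_eq_closure_inter_closure]
      exact fun x hx => ⟨subset_closure hx.2, hx.1⟩
    rw [h0] at h
    refine h.congr fun δ => ?_
    rw [Measure.restrict_apply' (hP i), inter_comm]
  have hsum : Tendsto (fun δ => μ (boundaryLayer P δ)) (𝓝[>] 0) (𝓝 0) := by
    have h := tendsto_finsetSum Finset.univ fun i _ => hcell i
    rw [Finset.sum_const_zero] at h
    exact tendsto_of_tendsto_of_tendsto_of_le_of_le tendsto_const_nhds h
      (fun δ => zero_le) fun δ => measure_iUnion_fintype_le μ _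
  have hreal := (ENNReal.tendsto_toReal ENNReal.zero_ne_top).comp hsum
  have := (hreal.eventually (gt_mem_nhds (by simpa using hε))).and self_mem_nhdsWithin
  obtain ⟨δ, h1, h2⟩ := this.exists
  exact ⟨δ, h2, h1⟩

/-! ### Three facts about measure-preserving maps -/

/-- Markov's inequality for the number of visits to `V` up to time `n`. -/
lemma measureReal_visits_ge_le {X : Type*} [MeasurableSpace X] {T : X → X} {μ : Measure X}
    [IsFiniteMeasure μ] (hT : MeasurePreserving T μ μ) {V : Set X} (hV : MeasurableSet V) {κ : ℝ}
    (hκ : 0 < κ) {n : ℕ} (hn : 0 < n) :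
    μ.real {x | κ * n ≤ ∑ k : Fin n, V.indicator (fun _ => (1 : ℝ)) (T^[k] x)}
      ≤ μ.real V / κ := by
  have hint : ∀ k : Fin n, Integrable (fun x => V.indicator (fun _ => (1 : ℝ)) (T^[k] x)) μ :=
    fun k => (hT.iterate k).integrable_comp_of_integrable
      ((integrable_const (1 : ℝ)).indicator hV)
  have hval : ∀ k : Fin n, ∫ x, V.indicator (fun _ => (1 : ℝ)) (T^[k] x) ∂μ = μ.real V := by
    intro k
    have h : (fun x => V.indicator (fun _ => (1 : ℝ)) (T^[k] x))
        = (T^[k] ⁻¹' V).indicator fun _ => (1 : ℝ) := rfl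
    rw [h, integral_indicator_const _ ((hT.iterate k).measurable hV), smul_eq_mul, mul_one,
      (hT.iterate k).measureReal_preimage hV.nullMeasurableSet]
  have h := mul_meas_ge_le_integral_of_nonneg (μ := μ)
    (f := fun x => ∑ k : Fin n, V.indicator (fun _ => (1 : ℝ)) (T^[k] x))
    (ae_of_all _ fun x => Finset.sum_nonneg fun k _ => indicator_nonneg (by simp) _)
    (integrable_finsetSum _ fun k _ => hint k) (κ * n)
  rw [integral_finsetSum _ fun k _ => hint k] at h
  simp only [hval, Finset.sum_const, Finset.card_univ, Fintype.card_fin, nsmul_eq_mul] at h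
  have hn' : (0 : ℝ) < n := by exact_mod_cast hn
  rw [le_div_iff₀ hκ]
  nlinarith

/-- A function that increases along the orbits of an ergodic map is almost everywhere constant;
this is the part of that fact which does not need the constant. -/
lemma ae_le_zero_or_exists_pos_ae_le {X : Type*} [MeasurableSpace X] {T : X → X} {μ : Measure X}
    [IsFiniteMeasure μ] (hT : Ergodic T μ) {f : X → ℝ} (hf : Measurable f)
    (hfT : ∀ x, f x ≤ f (T x)) :
    (∀ᵐ x ∂μ, f x ≤ 0) ∨ ∃ c > 0, ∀ᵐ x ∂μ, c ≤ f x := by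
  by_cases h : ∃ c > 0, ∀ᵐ x ∂μ, c ≤ f x
  · exact Or.inr h
  left
  push Not at h
  have hlt : ∀ m : ℕ, ∀ᵐ x ∂μ, f x < 1 / (m + 1) := by
    intro m
    have hm : (0 : ℝ) < 1 / (m + 1) := by positivity
    rcases hT.ae_empty_or_univ_of_ae_le_preimage (s := {x | 1 / ((m : ℝ) + 1) ≤ f x})
      (measurableSet_le measurable_const hf).nullMeasurableSet
      (LE.le.eventuallyLE fun x (hx : _ ≤ f x) => hx.trans (hfT x)) with he | hu
    · filter_upwards [ae_eq_empty.1 he |> measure_eq_zero_iff_ae_notMem.1] with x hx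
      exact not_le.1 hx
    · refine absurd ?_ (h _ hm)
      filter_upwards [eventuallyEq_univ.1 hu] with x hx
      exact not_lt.2 hx
  filter_upwards [ae_all_iff.2 hlt] with x hx
  exact le_of_forall_pos_lt_add fun ε hε => by
    obtain ⟨m, hm⟩ := exists_nat_one_div_lt hε
    simpa using (hx m).trans hm

/-- A maximal disjoint subfamily of sets of measure at least `c` has at most `1 / c` members, and
its members meet all the sets of the family. -/
lemma exists_finset_inter_nonempty {X Y : Type*} [MeasurableSpace X] {μ : Measure X}
    [IsProbabilityMeasure μ] {R : Y → Set X} (hR : ∀ y, MeasurableSet (R y)) {G : Set Y} {c : ℝ}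
    (hc : 0 < c) (hG : ∀ y ∈ G, c ≤ μ.real (R y)) :
    ∃ t : Finset Y, ↑t ⊆ G ∧ t.card * c ≤ 1 ∧ ∀ x ∈ G, ∃ y ∈ t, (R x ∩ R y).Nonempty := by
  classical
  have hcard : ∀ t : Finset Y, ↑t ⊆ G → (t : Set Y).PairwiseDisjoint R → t.card * c ≤ 1 := by
    intro t htG htd
    calc t.card * c = ∑ _y ∈ t, c := by simp
      _ ≤ ∑ y ∈ t, μ.real (R y) := Finset.sum_le_sum fun y hy => hG y (htG hy)
      _ = μ.real (⋃ y ∈ t, R y) := (measureReal_biUnion_finset htd fun y _ => hR y).symm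
      _ ≤ 1 := measureReal_le_one
  by_contra hno
  push Not at hno
  have hgrow : ∀ m : ℕ, ∃ t : Finset Y, t.card = m ∧ ↑t ⊆ G ∧
      (t : Set Y).PairwiseDisjoint R := by
    intro m
    induction m with
    | zero => exact ⟨∅, by simp⟩
    | succ m ih =>
      obtain ⟨t, rfl, htG, htd⟩ := ih
      obtain ⟨x, hxG, hx⟩ := hno t htG (hcard t htG htd)
      have hxt : x ∉ t := fun hxt => by
        have h0 := hx x hxt
        rw [inter_self] at h0
        have := hG x hxG
        rw [h0, measureReal_empty] at this
        linarith
      refine ⟨insert x t, Finset.card_insert_of_notMem hxt, ?_, ?_⟩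
      · rw [Finset.coe_insert]
        exact insert_subset hxG htG
      · rw [Finset.coe_insert]
        exact htd.insert fun y hy _ => disjoint_iff_inter_eq_empty.2 (hx y hy)
  obtain ⟨m, hm⟩ := exists_nat_gt (1 / c)
  obtain ⟨t, rfl, htG, htd⟩ := hgrow m
  rw [div_lt_iff₀ hc] at hm
  linarith [hcard t htG htd]

/-! ### Orbits that agree outside a small set -/

/-- The pairs whose orbits lie in the same cell of the partition `a` at all times at which at least
one of them is outside `V`. This relation is not transitive, but if `x` and `y` are both related to
`z`, the names of `x` and `y` differ only at times at which `x` or `y` visits `V`, whatever `z`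
does. -/
def agreeOff {X ι : Type*} (T : X → X) (a : X → ι) (V : Set X) : Set (X × X) :=
  {p | ∀ n : ℕ, (T^[n] p.1 ∉ V ∨ T^[n] p.2 ∉ V) → a (T^[n] p.1) = a (T^[n] p.2)}

lemma measurableSet_agreeOff {X ι : Type*} [MeasurableSpace X] [Countable ι] [MeasurableSpace ι]
    [MeasurableSingletonClass ι] {T : X → X} (hT : Measurable T) {a : X → ι} (ha : Measurable a)
    {V : Set X} (hV : MeasurableSet V) : MeasurableSet (agreeOff T a V) := by
  have h : agreeOff T a V = ⋂ n : ℕ, (((fun p : X × X => T^[n] p.1) ⁻¹' V)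
      ∩ ((fun p : X × X => T^[n] p.2) ⁻¹' V))
      ∪ {p : X × X | a (T^[n] p.1) = a (T^[n] p.2)} := by
    ext p
    simp only [agreeOff, mem_ofPred_eq, mem_iInter, mem_union, mem_inter_iff, mem_preimage]
    exact forall_congr' fun n => by tauto
  rw [h]
  have h1 : ∀ n, Measurable fun p : X × X => T^[n] p.1 := fun n =>
    (hT.iterate n).comp measurable_fst
  have h2 : ∀ n, Measurable fun p : X × X => T^[n] p.2 := fun n =>
    (hT.iterate n).comp measurable_snd
  exact MeasurableSet.iInter fun n => ((h1 n hV).inter (h2 n hV)).union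
    (measurableSet_eq_fun (ha.comp (h1 n)) (ha.comp (h2 n)))

lemma agreeOff_map {X ι : Type*} {T : X → X} {a : X → ι} {V : Set X} {x y : X}
    (h : (x, y) ∈ agreeOff T a V) : (T x, T y) ∈ agreeOff T a V := fun n hn =>
  h (n + 1) hn

lemma hammingDist_le_visits {X ι : Type*} [DecidableEq ι] {T : X → X} {a : X → ι} {V : Set X}
    {x y z : X} (hx : (x, z) ∈ agreeOff T a V) (hy : (y, z) ∈ agreeOff T a V) (n : ℕ) :
    (hammingDist (fun k : Fin n => a (T^[k] x)) (fun k : Fin n => a (T^[k] y)) : ℝ)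
      ≤ (∑ k : Fin n, V.indicator (fun _ => (1 : ℝ)) (T^[k] x))
        + ∑ k : Fin n, V.indicator (fun _ => (1 : ℝ)) (T^[k] y) := by
  rw [hammingDist, Finset.card_filter, Nat.cast_sum, ← Finset.sum_add_distrib]
  refine Finset.sum_le_sum fun k _ => ?_
  have h0 : ∀ u, 0 ≤ V.indicator (fun _ => (1 : ℝ)) u := indicator_nonneg (by simp)
  by_cases hVx : T^[k] x ∈ V
  · have := h0 (T^[k] y)
    rw [indicator_of_mem hVx]
    split_ifs <;> simp <;> linarith
  by_cases hVy : T^[k] y ∈ V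
  · have := h0 (T^[k] x)
    rw [indicator_of_mem hVy]
    split_ifs <;> simp <;> linarith
  have := (hx k (Or.inl hVx)).trans (hy k (Or.inl hVy)).symm
  simpa [this] using add_nonneg (h0 _) (h0 _)

/-- If almost every point is related to a set of points of measure at least `c`, then at each time
boundedly many names suffice to approximate, in Hamming distance, the names of all points with few
visits to `V`. This bounds the entropy. -/
lemma metricEntropy_le_of_agreeOff {X ι : Type*} [MeasurableSpace X] [Fintype ι]
    [MeasurableSpace ι] [MeasurableSingletonClass ι] {T : X → X} {μ : Measure X}
    [IsProbabilityMeasure μ] (hT : MeasurePreserving T μ μ) {a : X → ι} (ha : Measurable a)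
    {V : Set X} (hV : MeasurableSet V) {c : ℝ} (hc : 0 < c)
    (hR : ∀ᵐ x ∂μ, c ≤ μ.real (Prod.mk x ⁻¹' agreeOff T a V)) {b κ : ℝ} (hb : 0 ≤ b)
    (hκ : 0 < κ) :
    metricEntropy T μ (fun i => a ⁻¹' {i}) * Real.log 2 ≤ Fintype.card ι * Real.exp (-b)
      + b * (2 * κ) + μ.real V / κ * Real.log (Fintype.card ι) := by
  classical
  have : Nonempty X := μ.nonempty_of_neZero
  have : Nonempty ι := this.map a
  set r : ℝ := Fintype.card ι * Real.exp (-b) + b * (2 * κ)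
    + μ.real V / κ * Real.log (Fintype.card ι) with hr
  have hP : IsMeasurablePartition (fun i => a ⁻¹' {i}) :=
    ⟨fun i => ha (measurableSet_singleton i),
      fun i j hij => Disjoint.preimage a (by simpa using hij),
      by rw [← preimage_iUnion]; simp [iUnion_of_singleton]⟩
  set M : ℕ := ⌈1 / c⌉₊ with hM
  have hM0 : 0 < M := Nat.ceil_pos.2 (by positivity)
  have hbound : ∀ n : ℕ, 0 < n →
      shannonEntropy μ (joinCells T (fun i => a ⁻¹' {i}) n) * Real.log 2
        ≤ Real.log (2 * M) + n * r := by
    intro n hn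
    set word : X → Fin n → ι := fun x k => a (T^[k] x) with hword
    have hwm : ∀ s, MeasurableSet (word ⁻¹' {s}) := by
      intro s
      have hm : Measurable word := measurable_pi_lambda _ fun k => ha.comp (hT.measurable.iterate k)
      exact hm (measurableSet_singleton s)
    have hcells : joinCells T (fun i => a ⁻¹' {i}) n = fun s => word ⁻¹' {s} := by
      funext s
      ext x
      simp [joinCells, hword, funext_iff]
    set G : Set X := {x | c ≤ μ.real (Prod.mk x ⁻¹' agreeOff T a V)
      ∧ ∑ k : Fin n, V.indicator (fun _ => (1 : ℝ)) (T^[k] x) < κ * n} with hG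
    have hGc : μ.real Gᶜ ≤ μ.real V / κ := by
      refine le_trans ?_ (measureReal_visits_ge_le hT hV hκ hn)
      refine ENNReal.toReal_mono (measure_ne_top _ _) (measure_mono_ae ?_)
      filter_upwards [hR] with x hx hxG
      by_contra hlt
      exact hxG ⟨hx, not_le.1 hlt⟩
    obtain ⟨t, htG, htc, ht⟩ := exists_finset_inter_nonempty (μ := μ) (G := G)
      (fun x => measurable_prodMk_left (measurableSet_agreeOff hT.measurable ha hV)) hc
      fun x hx => hx.1
    have htM : t.card ≤ M := by
      rw [← le_div_iff₀ hc] at htc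
      exact_mod_cast htc.trans (Nat.le_ceil _)
    have hκn : 0 ≤ 2 * κ * n := by positivity
    have h := entropy_le_of_hammingDist_le (p := fun s => μ.real (word ⁻¹' {s}))
      (t := t.image word) (A := Finset.univ.filter fun s => ∃ x ∈ G, word x = s) (M := M)
      (b := b) (D := 2 * κ * n) (η := μ.real V / κ) (fun s => measureReal_nonneg)
      (by simpa using sum_measureReal_preimage_singleton (μ := μ) Finset.univ fun s _ => hwm s)
      hM0 (Finset.card_image_le.trans htM) hb hκn
      (by
        intro s hs
        obtain ⟨x, hx, rfl⟩ := (Finset.mem_filter.1 hs).2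
        obtain ⟨y, hy, z, hzx, hzy⟩ := ht x hx
        refine ⟨word y, Finset.mem_image_of_mem _ hy, ?_⟩
        have := hammingDist_le_visits hzx hzy n
        have h1 := hx.2
        have h2 := (htG hy).2
        linarith)
      (by
        refine le_trans ?_ hGc
        rw [sum_measureReal_preimage_singleton _ fun s _ => hwm s]
        refine measureReal_mono fun x hx hxG => ?_
        simp only [Finset.coe_compl, mem_preimage, mem_compl_iff, Finset.mem_coe,
          Finset.mem_filter, Finset.mem_univ, true_and] at hx
        exact hx ⟨x, hxG, rfl⟩)
    have hl := (Real.log_pos one_lt_two).ne'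
    have he : shannonEntropy μ (fun s => word ⁻¹' {s}) * Real.log 2
        = -∑ s, μ.real (word ⁻¹' {s}) * Real.log (μ.real (word ⁻¹' {s})) := by
      simp only [shannonEntropy, Real.logb, ← mul_div_assoc, ← Finset.sum_div]
      field_simp
    rw [hcells, he]
    refine h.trans (le_of_eq ?_)
    rw [hr]
    ring
  have h1 := (tendsto_metricEntropy hT hP).mul_const (Real.log 2)
  have h2 : Tendsto (fun n : ℕ => Real.log (2 * M) / (n : ℝ) + r) atTop (𝓝 (0 + r)) :=
    (tendsto_const_div_atTop_nhds_zero_nat _).add_const r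
  rw [zero_add] at h2
  refine le_of_tendsto_of_tendsto h1 h2 ?_
  filter_upwards [eventually_gt_atTop 0] with n hn
  have hn' : (0 : ℝ) < n := by exact_mod_cast hn
  have := hbound n hn
  rw [div_mul_eq_mul_div, div_le_iff₀ hn', add_mul, div_mul_cancel₀ _ hn'.ne']
  linarith

/-- The three error terms of `metricEntropy_le_of_agreeOff` can be made small together: `b`, `κ` and
`ε` are chosen in this order, so that each term is at most `h / 4`. -/
lemma exists_error_lt {h L ℓ : ℝ} (hh : 0 < h) (hL : 0 ≤ L) (hℓ : 0 ≤ ℓ) :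
    ∃ b κ ε : ℝ, 0 ≤ b ∧ 0 < κ ∧ 0 < ε ∧
      ∀ v < ε, L * Real.exp (-b) + b * (2 * κ) + v / κ * ℓ < h := by
  set b : ℝ := 4 * L / h with hb
  have hb0 : 0 ≤ b := by positivity
  set κ : ℝ := h / (8 * (b + 1)) with hκ
  have hκ0 : 0 < κ := by positivity
  refine ⟨b, κ, h / 4 * κ / (ℓ + 1), hb0, hκ0, by positivity, fun v hv => ?_⟩
  have h1 : L * Real.exp (-b) ≤ h / 4 := by
    have hexp : b ≤ Real.exp b := by linarith [Real.add_one_le_exp b]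
    rw [Real.exp_neg, ← div_eq_mul_inv, div_le_iff₀ (Real.exp_pos b)]
    have hbh : b * h = 4 * L := by rw [hb]; field_simp
    nlinarith
  have h2 : b * (2 * κ) ≤ h / 4 := by
    have : κ * (8 * (b + 1)) = h := by rw [hκ]; field_simp
    nlinarith
  have h3 : v / κ * ℓ ≤ h / 4 := by
    rw [lt_div_iff₀ (by positivity)] at hv
    rw [div_mul_eq_mul_div, div_le_iff₀ hκ0]
    rcases le_total 0 v with hv0 | hv0
    · nlinarith
    · have : v * ℓ ≤ 0 := mul_nonpos_of_nonpos_of_nonneg hv0 hℓ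
      have : 0 < h / 4 * κ := by positivity
      linarith
  linarith

end SymmetricSensitivity

theorem theorem3p1 {X : Type*} [MetricSpace X] [MeasurableSpace X] [OpensMeasurableSpace X]
    (μ : Measure X) [IsProbabilityMeasure μ] (T : X → X) (hT : Ergodic T μ)
    (l : ℕ) (P : Fin l → Set X)
    (hP : SymmetricSensitivity.IsMeasurablePartition P)
    (hcont : ∀ i, SymmetricSensitivity.IsContinuitySet μ (P i))
    (hpos : 0 < SymmetricSensitivity.metricEntropy T μ P) :
    SymmetricSensitivity.SymmetricallySensitive T μ := by
  open SymmetricSensitivity in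
  have hcover : ∀ x, ∃ i, x ∈ P i := fun x => mem_iUnion.1 (hP.iUnion_eq ▸ mem_univ x)
  choose a ha using hcover
  have hiff : ∀ x i, x ∈ P i ↔ a x = i := fun x i =>
    ⟨fun hx => by
      by_contra hne
      exact Set.disjoint_left.1 (hP.pairwise_disjoint hne) (ha x) hx, fun h => h ▸ ha x⟩
  have hPa : P = fun i => a ⁻¹' {i} := by
    funext i
    ext x
    simp [hiff]
  have ham : Measurable a := measurable_to_countable' fun i => by
    have := hP.measurableSet i
    rwa [hPa] at this
  obtain ⟨b, κ, ε, hb, hκ, hε, herr⟩ := exists_error_lt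
    (mul_pos hpos (Real.log_pos one_lt_two)) (Nat.cast_nonneg (Fintype.card (Fin l)))
    (Real.log_natCast_nonneg (Fintype.card (Fin l)))
  obtain ⟨δ, hδ, hδV⟩ := exists_measureReal_boundaryLayer_lt hP.measurableSet hcont hε
  set V := boundaryLayer P δ with hVdef
  have hV : MeasurableSet V := measurableSet_boundaryLayer hP.measurableSet δ
  have hRm := measurableSet_agreeOff hT.measurable ham hV
  have hsec : ∀ x, MeasurableSet (Prod.mk x ⁻¹' agreeOff T a V) := fun x =>
    measurable_prodMk_left hRm
  refine ⟨δ, hδ, ?_⟩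
  rcases ae_le_zero_or_exists_pos_ae_le hT
    (f := fun x => μ.real (Prod.mk x ⁻¹' agreeOff T a V))
    (measurable_measure_prodMk_left hRm).ennreal_toReal
    (fun x => by
      rw [← hT.toMeasurePreserving.measureReal_preimage (hsec (T x)).nullMeasurableSet]
      exact measureReal_mono fun y hy => agreeOff_map hy) with h0 | ⟨c, hc, hcR⟩
  · have hnull : μ.prod μ (agreeOff T a V) = 0 := by
      rw [Measure.measure_prod_null hRm]
      filter_upwards [h0] with x hx
      exact (measureReal_eq_zero_iff (measure_ne_top _ _)).1 (le_antisymm hx measureReal_nonneg)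
    -- The set of non-separated pairs need not be measurable for the product σ-algebra when `X` is
    -- not separable; it is enough that it lies in the measurable null set `agreeOff T a V`.
    filter_upwards [measure_eq_zero_iff_ae_notMem.1 hnull] with p hp
    by_contra! hclose
    refine hp fun n hn => ?_
    rcases hn with hn | hn
    · exact ((hiff _ _).1 (mem_of_notMem_boundaryLayer hn (hclose n) (ha _))).symm
    · refine (hiff _ _).1 (mem_of_notMem_boundaryLayer hn ?_ (ha _))
      rw [dist_comm]
      exact hclose n
  · have h := metricEntropy_le_of_agreeOff hT.toMeasurePreserving ham hV hc hcR hb hκ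
    rw [← hPa] at h
    exact absurd h (not_le.2 (herr _ hδV))
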